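/- Let $X$ be an infinite set (of atoms), let $\mathbb{V}(X)=\bigcup_n V_n(X)$ be its superstructure ($V_0(X)=X$, $V_{n+1}(X)=V_n(X)\cup\wp(V_n(X))$), and let $\langle\mathbb{V}(X),\mathbb{V}(X),\ast\rangle$ be a single superstructure model of nonstandard methods, i.e. $\ast:\mathbb{V}(X)\to\mathbb{V}(X)$ satisfies the transfer principle for bounded quantifier formulas. Put $S_0=\mathrm{id}$ and $S_{n+1}=\ast\circ S_n$ for the iterates of the star map. For an ultrafilter $\mathcal U$ on a set $Y\in\mathbb V(X)$ put $\mu_n(\mathcal U)=\bigcap_{A\in\mathcal U}S_n(A)$, $\mu=\mu_1$; the elements of $\mu_\infty(\mathcal U)=\bigcap_{A\in\mathcal U}\bigcup_{n}S_n(A)$ are called generators of $\mathcal U$. A set $Y\in\mathbb V(X)$ is completely coherent if $A\subseteq{}^{\ast}A$ for every $A\subseteq Y$. For $\alpha\in S_n(Y)$ let $\mathfrak U_\alpha=\{A\subseteq Y\mid \alpha\in S_n(A)\}$ be the ultrafilter on $Y$ generated by $\alpha$ (in the extension $S_n$); for $\alpha\in S_m(Y)$ and $\beta\in S_n(Y)$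 write $\alpha\sim_Y\beta$ if $\{A\subseteq Y\mid\alpha\in S_m(A)\}=\{A\subseteq Y\mid\beta\in S_n(A)\}$. The tensor product $\mathcal U_1\otimes\dots\otimes\mathcal U_{k+1}$ of ultrafilters $\mathcal U_i$ on sets $Y_i$ is the ultrafilter on $Y_1\times\dots\times Y_{k+1}$ such that $A$ belongs to it iff $\{s_1\in Y_1\mid\{s_2\in Y_2\mid\dots\{s_{k+1}\in Y_{k+1}\mid(s_1,\dots,s_{k+1})\in A\}\in\mathcal U_{k+1}\dots\}\in\mathcal U_2\}\in\mathcal U_1$. A tuple $(\alpha_1,\dots,\alpha_{k+1})\in{}^{\ast}(Y_1\times\dots\times Y_{k+1})$ is a tensor $(k+1)$-ple if $\mathfrak U_{(\alpha_1,\dots,\alpha_{k+1})}=\mathfrak U_{\alpha_1}\otimes\dots\otimes\mathfrak U_{\alpha_{k+1}}$. Theorem. Let $k\ge 0$ and let $Y_1,\dots,Y_{k+1}\in\mathbb V(X)$ be sets with $Y_1,\dots,Y_k$ completely coherent. (a) For every $i\le k+1$ let $\mathcal U_i$ be an ultrafilter on $Y_i$ and let $\alpha_i\in\mu(\mathcal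 U_i)$. Then $(\alpha_1,{}^{\ast}\alpha_2,\dots,S_k(\alpha_{k+1}))\in\mu_{k+1}(\mathcal U_1\otimes\dots\otimes\mathcal U_{k+1})$; in particular this tuple is a generator of $\mathcal U_1\otimes\dots\otimes\mathcal U_{k+1}$. (b) For every $i\le k+1$ let $\alpha_i\in{}^{\ast}Y_i$. Then $(\alpha_1,\dots,\alpha_{k+1})$ is a tensor $(k+1)$-ple if and only if $$(\alpha_1,\dots,\alpha_{k+1})\sim_{Y_1\times\dots\times Y_{k+1}}(\alpha_1,{}^{\ast}\alpha_2,\dots,S_k(\alpha_{k+1})).$$ -/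

import Mathlib

universe u

namespace Nonstandard

/-- The finite levels of the superstructure on `X`:
`V_0(X) = X` and `V_{n+1}(X) = V_n(X) ∪ ℘(V_n(X))`. -/
def level (X : ZFSet.{u}) : ℕ → ZFSet.{u}
  | 0 => X
  | n + 1 => level X n ∪ (level X n).powerset

/-- The superstructure `𝕍(X) = ⋃ₙ V_n(X)`. -/
def Superstructure (X : ZFSet.{u}) : Type (u + 1) := {a : ZFSet.{u} // ∃ n, a ∈ level X n}

/-- Membership in the superstructure is membership of sets. -/
instance {X : ZFSet.{u}} : Membership (Superstructure X) (Superstructure X) :=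
  ⟨fun b a => a.1 ∈ b.1⟩

/-- The usual convention that the elements of `X` are atoms (urelements) relative to `𝕍(X)`:
they are nonempty, and none of their elements belongs to `𝕍(X)`. -/
def IsBaseSet (X : ZFSet.{u}) : Prop :=
  ∅ ∉ X ∧ ∀ x ∈ X, ∀ y ∈ x, ∀ n, y ∉ level X n

/-- Bounded quantifier formulas of the language `{=, ∈}` in the free variables `x_0, …, x_{n-1}`.
In `ballMem i φ`, i.e. `∀ y ∈ x_i, φ`, the bound variable `y` is the variable `0` of `φ`
and the variables of the formula are shifted by one. -/
inductive BddFormula : ℕ → Type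
  | eq {n : ℕ} (i j : Fin n) : BddFormula n
  | mem {n : ℕ} (i j : Fin n) : BddFormula n
  | neg {n : ℕ} (φ : BddFormula n) : BddFormula n
  | and {n : ℕ} (φ ψ : BddFormula n) : BddFormula n
  | ballMem {n : ℕ} (i : Fin n) (φ : BddFormula (n + 1)) : BddFormula n

/-- Satisfaction of bounded quantifier formulas in `𝕍(X)`. -/
def BddFormula.Holds {X : ZFSet.{u}} : {n : ℕ} → BddFormula n → (Fin n → Superstructure X) → Prop
  | _, .eq i j, v => v i = v j
  | _, .mem i j, v => v i ∈ v j
  | _, .neg φ, v => ¬ φ.Holds v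
  | _, .and φ ψ, v => φ.Holds v ∧ ψ.Holds v
  | _, .ballMem i φ, v => ∀ y : Superstructure X, y ∈ v i → φ.Holds (Fin.cons y v)

/-- A single superstructure model of nonstandard methods `⟨𝕍(X), 𝕍(X), ∗⟩`: `X` is an infinite
set of atoms and `∗ : 𝕍(X) → 𝕍(X)` satisfies the transfer principle. -/
structure SingleModel (X : ZFSet.{u}) where
  base : IsBaseSet X
  infinite : {x : ZFSet.{u} | x ∈ X}.Infinite
  star : Superstructure X → Superstructure X
  transfer : ∀ {n : ℕ} (φ : BddFormula n) (v : Fin n → Superstructure X),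
    φ.Holds v ↔ φ.Holds (fun i => star (v i))

theorem level_mono (X : ZFSet.{u}) {m n : ℕ} (h : m ≤ n) : level X m ⊆ level X n := by
  induction h with
  | refl => exact fun _ h => h
  | step _ ih => exact fun _ h => ZFSet.mem_union.2 (Or.inl (ih h))

/-! ### Sets in the superstructure -/

/-- The sets in `𝕍(X)`: the members of `⋃ₙ ℘(V_n(X))`. For a base set `X` these are
exactly the elements of `𝕍(X)` that are not atoms. -/
def VSet (X : ZFSet.{u}) : Type (u + 1) := {S : ZFSet.{u} // ∃ n, S ⊆ level X n}

/-- A set in `𝕍(X)`, as an element of `𝕍(X)`. -/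
def VSet.toV {X : ZFSet.{u}} (S : VSet X) : Superstructure X :=
  ⟨S.1, S.2.elim fun n hn => ⟨n + 1, ZFSet.mem_union.2 (Or.inr (ZFSet.mem_powerset.2 hn))⟩⟩

/-- The type of elements of a set in `𝕍(X)`. -/
def VSet.Elem {X : ZFSet.{u}} (S : VSet X) : Type (u + 1) := {a : Superstructure X // a ∈ S.toV}

instance {X : ZFSet.{u}} : CoeSort (VSet X) (Type (u + 1)) := ⟨VSet.Elem⟩

/-- A subset `A ⊆ S` of a set in `𝕍(X)` is itself a set in `𝕍(X)`. -/
def VSet.sub {X : ZFSet.{u}} (S : VSet X) (A : Set S) : VSet X :=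
  ⟨ZFSet.sep (fun a => ∃ b : S, b ∈ A ∧ b.1.1 = a) S.1,
    S.2.elim fun n hn => ⟨n, fun _ ha => hn (ZFSet.mem_sep.1 ha).1⟩⟩

theorem VSet.mem_sub {X : ZFSet.{u}} (S : VSet X) (A : Set S) (a : Superstructure X) :
    a ∈ (S.sub A).toV ↔ ∃ h : a ∈ S.toV, (⟨a, h⟩ : S) ∈ A := by
  have key : a ∈ (S.sub A).toV ↔ a.1 ∈ S.1 ∧ ∃ b : S, b ∈ A ∧ b.1.1 = a.1 :=
    ZFSet.mem_sep (p := fun a => ∃ b : S, b ∈ A ∧ b.1.1 = a)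
  rw [key]
  constructor
  · rintro ⟨h1, b, hb, hab⟩
    refine ⟨h1, ?_⟩
    have : b = (⟨a, h1⟩ : S) := Subtype.ext (Subtype.ext hab)
    exact this ▸ hb
  · rintro ⟨h1, h2⟩
    exact ⟨h1, ⟨a, h1⟩, h2, rfl⟩

theorem pair_mem_level {X a b : ZFSet.{u}} {m n : ℕ} (ha : a ∈ level X m) (hb : b ∈ level X n) :
    ZFSet.pair a b ∈ level X (max m n + 2) := by
  have ha' := level_mono X (le_max_left m n) ha
  have hb' := level_mono X (le_max_right m n) hb
  refine ZFSet.mem_union.2 (Or.inr (ZFSet.mem_powerset.2 fun x hx => ?_))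
  refine ZFSet.mem_union.2 (Or.inr (ZFSet.mem_powerset.2 fun y hy => ?_))
  simp only [ZFSet.pair, ZFSet.mem_pair] at hx
  rcases hx with rfl | rfl
  · rw [ZFSet.mem_singleton] at hy
    exact hy ▸ ha'
  · rw [ZFSet.mem_pair] at hy
    rcases hy with rfl | rfl
    exacts [ha', hb']

/-- The (Kuratowski) ordered pair in `𝕍(X)`. -/
def pair {X : ZFSet.{u}} (a b : Superstructure X) : Superstructure X :=
  ⟨ZFSet.pair a.1 b.1,
    a.2.elim fun _ hm => b.2.elim fun _ hn => ⟨_, pair_mem_level hm hn⟩⟩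

/-- The Cartesian product of two sets in `𝕍(X)`. -/
def VSet.prod {X : ZFSet.{u}} (S T : VSet X) : VSet X :=
  ⟨ZFSet.prod S.1 T.1, by
    obtain ⟨m, hm⟩ := S.2
    obtain ⟨n, hn⟩ := T.2
    refine ⟨max m n + 2, fun p hp => ?_⟩
    obtain ⟨a, ha, b, hb, rfl⟩ := ZFSet.mem_prod.1 hp
    exact pair_mem_level (hm ha) (hn hb)⟩

/-- The pair `(s, t)` as an element of `S × T`. -/
def VSet.mkPair {X : ZFSet.{u}} {S T : VSet X} (s : S) (t : T) : S.prod T :=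
  ⟨pair s.1 t.1, ZFSet.mem_prod.2 ⟨_, s.2, _, t.2, rfl⟩⟩

/-- The product `S_1 × ⋯ × S_{k+1}` (indexed from `0`), namely `S_1 × (S_2 × (⋯ × S_{k+1}))`. -/
def prodN {X : ZFSet.{u}} : {k : ℕ} → (Fin (k + 1) → VSet X) → VSet X
  | 0, S => S 0
  | _ + 1, S => (S 0).prod (prodN fun i => S i.succ)

/-- The tuple `(a_1, …, a_{k+1})` (indexed from `0`), namely `(a_1, (a_2, (…, a_{k+1})))`. -/
def tuple {X : ZFSet.{u}} : {k : ℕ} → (Fin (k + 1) → Superstructure X) → Superstructure X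
  | 0, a => a 0
  | _ + 1, a => pair (a 0) (tuple fun i => a i.succ)

/-! ### Tensor products of ultrafilters -/

/-- The tensor product `𝒰 ⊗ 𝒱` on `S × T`. -/
def tensor₂ {X : ZFSet.{u}} {S T : VSet X} (U : Ultrafilter S) (V : Ultrafilter T) :
    Ultrafilter (S.prod T) :=
  U.bind fun s => V.map fun t => VSet.mkPair s t

theorem mem_tensor₂ {X : ZFSet.{u}} {S T : VSet X} (U : Ultrafilter S) (V : Ultrafilter T)
    (A : Set (S.prod T)) :
    A ∈ tensor₂ U V ↔ {s : S | {t : T | VSet.mkPair s t ∈ A} ∈ V} ∈ U :=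
  Iff.rfl

/-- The tensor product `𝒰_1 ⊗ ⋯ ⊗ 𝒰_{k+1}` on `S_1 × ⋯ × S_{k+1}`: a set `A` belongs to it iff
`{s_1 | {s_2 | … {s_{k+1} | (s_1, …, s_{k+1}) ∈ A} ∈ 𝒰_{k+1} …} ∈ 𝒰_2} ∈ 𝒰_1`. -/
def tensorN {X : ZFSet.{u}} : {k : ℕ} → {S : Fin (k + 1) → VSet X} →
    ((i : Fin (k + 1)) → Ultrafilter (S i)) → Ultrafilter (prodN S)
  | 0, _, U => U 0
  | _ + 1, _, U => tensor₂ (U 0) (tensorN fun i => U i.succ)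

namespace SingleModel

variable {X : ZFSet.{u}} (M : SingleModel X)

/-- The iterated star map: `S_0 = id`, `S_{n+1} = ∗ ∘ S_n`. -/
def iter {X : ZFSet.{u}} (M : SingleModel X) : ℕ → Superstructure X → Superstructure X
  | 0 => id
  | n + 1 => M.star ∘ iter M n

/-- `Y` is coherent if `Y ⊆ ∗Y`. -/
def Coherent (Y : VSet X) : Prop := ∀ y : Superstructure X, y ∈ Y.toV → y ∈ M.star Y.toV

/-- `Y` is completely coherent if every subset of `Y` is coherent. -/
def CompletelyCoherent (Y : VSet X) : Prop := ∀ A : Set Y, M.Coherent (Y.sub A)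

/-- `μ_n(𝒰) = ⋂_{A ∈ 𝒰} S_n(A)`. -/
def monad (n : ℕ) {Y : VSet X} (U : Ultrafilter Y) : Set (Superstructure X) :=
  {α | ∀ A ∈ U, α ∈ M.iter n (Y.sub A).toV}

/-- The set `μ_∞(𝒰) = ⋂_{A ∈ 𝒰} ⋃ₙ S_n(A)` of generators of `𝒰`. -/
def generators {Y : VSet X} (U : Ultrafilter Y) : Set (Superstructure X) :=
  {α | ∀ A ∈ U, ∃ n, α ∈ M.iter n (Y.sub A).toV}

/-- The family `{A ⊆ Y | α ∈ S_n(A)}` generated on `Y` by `α` in the extension `S_n`. -/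
def genSets (n : ℕ) (Y : VSet X) (α : Superstructure X) : Set (Set Y) :=
  {A | α ∈ M.iter n (Y.sub A).toV}

theorem transfer_iter (m : ℕ) {n : ℕ} (φ : BddFormula n) (v : Fin n → Superstructure X) :
    φ.Holds v ↔ φ.Holds (fun i => M.iter m (v i)) := by
  induction m with
  | zero => exact Iff.rfl
  | succ m ih => exact ih.trans (M.transfer φ _)

theorem genSets_mono (n : ℕ) {Y : VSet X} {α : Superstructure X} {A B : Set Y} (h : A ⊆ B)
    (hA : A ∈ M.genSets n Y α) : B ∈ M.genSets n Y α := by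
  have key := M.transfer_iter n (BddFormula.ballMem 0 (BddFormula.mem 0 2))
    ![(Y.sub A).toV, (Y.sub B).toV]
  refine key.1 ?_ α hA
  intro y hy
  obtain ⟨h1, h2⟩ := (VSet.mem_sub _ _ _).1 hy
  exact (VSet.mem_sub _ _ _).2 ⟨h1, h h2⟩

theorem genSets_inter (n : ℕ) {Y : VSet X} {α : Superstructure X} {A B : Set Y}
    (hA : A ∈ M.genSets n Y α) (hB : B ∈ M.genSets n Y α) : A ∩ B ∈ M.genSets n Y α := by
  have key := M.transfer_iter n
    (BddFormula.ballMem 0 (BddFormula.neg ((BddFormula.mem 0 2).and (BddFormula.mem 0 3).neg)))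
    ![(Y.sub A).toV, (Y.sub B).toV, (Y.sub (A ∩ B)).toV]
  by_contra hc
  refine key.1 ?_ α hA ⟨hB, hc⟩
  rintro y hy ⟨hy', hy''⟩
  obtain ⟨h1, h2⟩ := (VSet.mem_sub _ _ _).1 hy
  obtain ⟨_, h4⟩ := (VSet.mem_sub _ _ _).1 hy'
  exact hy'' ((VSet.mem_sub _ _ _).2 ⟨h1, h2, h4⟩)

theorem genSets_compl (n : ℕ) {Y : VSet X} {α : Superstructure X} (hα : α ∈ M.iter n Y.toV)
    (A : Set Y) : Aᶜ ∉ M.genSets n Y α ↔ A ∈ M.genSets n Y α := by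
  constructor
  · intro h
    have key := M.transfer_iter n
      (BddFormula.ballMem 0 (BddFormula.neg ((BddFormula.mem 0 2).neg.and (BddFormula.mem 0 3).neg)))
      ![Y.toV, (Y.sub A).toV, (Y.sub Aᶜ).toV]
    by_contra hc
    refine key.1 ?_ α hα ⟨hc, h⟩
    rintro y hy ⟨hy', hy''⟩
    by_cases hA : (⟨y, hy⟩ : Y) ∈ A
    · exact hy' ((VSet.mem_sub _ _ _).2 ⟨hy, hA⟩)
    · exact hy'' ((VSet.mem_sub _ _ _).2 ⟨hy, hA⟩)
  · intro h h'
    have key := M.transfer_iter n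
      (BddFormula.ballMem 0 (BddFormula.mem 0 2).neg) ![(Y.sub A).toV, (Y.sub Aᶜ).toV]
    refine key.1 ?_ α h h'
    intro y hy hy'
    obtain ⟨_, h2⟩ := (VSet.mem_sub _ _ _).1 hy
    obtain ⟨_, h4⟩ := (VSet.mem_sub _ _ _).1 hy'
    exact h4 h2

/-- The ultrafilter `𝔘_α = {A ⊆ Y | α ∈ S_n(A)}` on `Y` generated by `α ∈ S_n(Y)`. -/
def ultrafilter (n : ℕ) (Y : VSet X) (α : Superstructure X) (hα : α ∈ M.iter n Y.toV) :
    Ultrafilter Y :=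
  Ultrafilter.ofComplNotMemIff
    { sets := M.genSets n Y α
      univ_sets := (M.genSets_compl n hα Set.univ).1 fun h =>
        (M.genSets_compl n hα Set.univ).2
          (M.genSets_mono n (Set.subset_univ _) h) h
      sets_of_superset := fun hA h => M.genSets_mono n h hA
      inter_sets := fun hA hB => M.genSets_inter n hA hB }
    fun A => M.genSets_compl n hα A

theorem mem_ultrafilter (n : ℕ) (Y : VSet X) (α : Superstructure X) (hα : α ∈ M.iter n Y.toV)
    (A : Set Y) : A ∈ M.ultrafilter n Y α hα ↔ α ∈ M.iter n (Y.sub A).toV :=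
  Iff.rfl

/-- `α ∼_Y β`, for `α ∈ S_m(Y)` and `β ∈ S_n(Y)`: the ultrafilters generated on `Y`
by `α` and by `β` coincide. -/
def Equivalent (Y : VSet X) (m : ℕ) (α : Superstructure X) (n : ℕ) (β : Superstructure X) : Prop :=
  M.genSets m Y α = M.genSets n Y β

/-- For `α_i ∈ ∗S_i`, the tuple `(α_1, …, α_{k+1})` is a tensor `(k+1)`-ple if the ultrafilter it
generates on `S_1 × ⋯ × S_{k+1}` is `𝔘_{α_1} ⊗ ⋯ ⊗ 𝔘_{α_{k+1}}`. -/
def IsTensorTuple {k : ℕ} (S : Fin (k + 1) → VSet X) (α : Fin (k + 1) → Superstructure X)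
    (hα : ∀ i, α i ∈ M.star (S i).toV) : Prop :=
  ∀ A : Set (prodN S), A ∈ M.genSets 1 (prodN S) (tuple α) ↔
    A ∈ tensorN fun i => M.ultrafilter 1 (S i) (α i) (hα i)

end SingleModel

end Nonstandard

namespace Nonstandard

/-! ### Extensionality and Kuratowski pairs in the superstructure -/

section Superstructure

variable {X : ZFSet.{u}}

/-! In a completely coherent set every element `s` is fixed by `∗`, since `s ∈ ∗{s} = {∗s}`. Let `A
∈ 𝒰 ⊗ 𝒱`, `α ∈ μ(𝒰)`, `β ∈ μ_n(𝒱)`. For each `s` in the set `B ∈ 𝒰` of points whose section `A_s` is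
in `𝒱`, transfer along `S_n` gives `(s, β) = (S_n s, β) ∈ S_n(A)` (`pair_iter_mem`). One more star,
applied to "for all `s ∈ B`", gives `(α, ∗β) ∈ S_{n+1}(A)` (`pair_star_mem`). Induction on `k`
yields (a), because `∗` commutes with tuples.

For (b), a member of `μ_n(𝒲)` generates exactly `𝒲`. By (a) the iterated tuple generates `𝔘_{α_1} ⊗
⋯ ⊗ 𝔘_{α_{k+1}}`, so both sides of the equivalence say the same. -/

theorem mem_or_subset_level {a : ZFSet.{u}} {n : ℕ} (h : a ∈ level X n) :
    a ∈ X ∨ ∃ m, a ⊆ level X m := by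
  induction n with
  | zero => exact Or.inl h
  | succ n ih =>
    rcases ZFSet.mem_union.1 h with h | h
    · exact ih h
    · exact Or.inr ⟨n, ZFSet.mem_powerset.1 h⟩

/-- The elements of a set in `𝕍(X)`, that is, of an element of `𝕍(X)` which is not an atom,
belong to `𝕍(X)`. -/
theorem IsBaseSet.exists_level_of_mem (hX : IsBaseSet X) {a b : Superstructure X} (hb : b ∈ a)
    {z : ZFSet.{u}} (hz : z ∈ a.1) : ∃ n, z ∈ level X n := by
  obtain ⟨n, hn⟩ := a.2
  rcases mem_or_subset_level hn with h | ⟨m, hm⟩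
  -- An atom has no element in `𝕍(X)`, so `b` rules this case out.
  · obtain ⟨k, hk⟩ := b.2
    exact absurd hk (hX.2 _ h _ hb k)
  · exact ⟨m, hm hz⟩

/-- Extensionality for nonempty sets in `𝕍(X)`. -/
theorem IsBaseSet.val_eq (hX : IsBaseSet X) {a b : Superstructure X} (hb : b ∈ a)
    {c : ZFSet.{u}} (hc : ∀ z ∈ c, ∃ n, z ∈ level X n)
    (h : ∀ z : Superstructure X, z ∈ a ↔ z.1 ∈ c) : a.1 = c := by
  ext z
  constructor
  · intro hz
    exact (h ⟨z, hX.exists_level_of_mem hb hz⟩).1 hz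
  · intro hz
    exact (h ⟨z, hc z hz⟩).2 hz

theorem eq_iff_val_eq {a b : Superstructure X} : a = b ↔ a.1 = b.1 := Subtype.ext_iff

theorem exists_pairSet (a b : Superstructure X) : ∃ c : Superstructure X, c.1 = {a.1, b.1} := by
  obtain ⟨m, hm⟩ := a.2
  obtain ⟨n, hn⟩ := b.2
  refine ⟨⟨{a.1, b.1}, max m n + 1, ZFSet.mem_union.2 (Or.inr (ZFSet.mem_powerset.2 ?_))⟩, rfl⟩
  intro z hz
  rcases ZFSet.mem_pair.1 hz with rfl | rfl
  exacts [level_mono X (le_max_left m n) hm, level_mono X (le_max_right m n) hn]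

/-- All quantifiers are bounded by `p`, `u` or `v`, so the right side can be written as a bounded
formula and transferred. Conversely, `p`, `u` and `v` each have an element in `𝕍(X)`, hence are not
atoms, and extensionality applies. -/
theorem pair_eq_iff (hX : IsBaseSet X) (p a b : Superstructure X) :
    p = pair a b ↔ ∃ u, u ∈ p ∧ ∃ v, v ∈ p ∧ (a ∈ u ∧ ∀ z, z ∈ u → z = a) ∧
      ((a ∈ v ∧ b ∈ v) ∧ ∀ z, z ∈ v → z = a ∨ z = b) ∧ ∀ w, w ∈ p → w = u ∨ w = v := by
  constructor
  · rintro rfl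
    obtain ⟨m, hm⟩ := exists_pairSet a a
    obtain ⟨n, hn⟩ := exists_pairSet a b
    have hmem : ∀ z : Superstructure X, z ∈ pair a b ↔ z = m ∨ z = n := fun z => by
      have : z ∈ pair a b ↔ z.1 ∈ ZFSet.pair a.1 b.1 := Iff.rfl
      simp [this, ZFSet.pair, eq_iff_val_eq, hm, hn]
    have hm' : ∀ z : Superstructure X, z ∈ m ↔ z = a := fun z => by
      have : z ∈ m ↔ z.1 ∈ m.1 := Iff.rfl
      simp [this, hm, eq_iff_val_eq]
    have hn' : ∀ z : Superstructure X, z ∈ n ↔ z = a ∨ z = b := fun z => by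
      have : z ∈ n ↔ z.1 ∈ n.1 := Iff.rfl
      simp [this, hn, eq_iff_val_eq]
    exact ⟨m, (hmem m).2 (.inl rfl), n, (hmem n).2 (.inr rfl),
      ⟨(hm' a).2 rfl, fun z => (hm' z).1⟩,
      ⟨⟨(hn' a).2 (.inl rfl), (hn' b).2 (.inr rfl)⟩, fun z => (hn' z).1⟩, fun w => (hmem w).1⟩
  · rintro ⟨u, hu, v, hv, ⟨hau, hu'⟩, ⟨⟨hav, hbv⟩, hv'⟩, hp⟩
    have eu : u.1 = {a.1} := hX.val_eq hau
      (fun z hz => by rw [ZFSet.mem_singleton.1 hz]; exact a.2) fun z => by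
        rw [ZFSet.mem_singleton]
        exact ⟨fun hz => congrArg _ (hu' z hz), fun hz => (Subtype.ext hz : z = a) ▸ hau⟩
    have ev : v.1 = {a.1, b.1} := hX.val_eq hav
      (fun z hz => by rcases ZFSet.mem_pair.1 hz with rfl | rfl; exacts [a.2, b.2]) fun z => by
        rw [ZFSet.mem_pair]
        constructor
        · intro hz
          exact (hv' z hz).imp (congrArg _) (congrArg _)
        · rintro (hz | hz)
          · exact (Subtype.ext hz : z = a) ▸ hav
          · exact (Subtype.ext hz : z = b) ▸ hbv
    refine Subtype.ext (hX.val_eq hu (c := ZFSet.pair a.1 b.1) ?_ fun z => ?_)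
    · intro z hz
      rw [ZFSet.pair, ← eu, ← ev, ZFSet.mem_pair] at hz
      rcases hz with rfl | rfl
      exacts [u.2, v.2]
    · rw [ZFSet.pair, ← eu, ← ev, ZFSet.mem_pair]
      constructor
      · intro hz
        exact (hp z hz).imp (congrArg _) (congrArg _)
      · rintro (hz | hz)
        · exact (Subtype.ext hz : z = u) ▸ hu
        · exact (Subtype.ext hz : z = v) ▸ hv

end Superstructure

/-! ### Pairs expressed by a bounded formula -/

namespace BddFormula

/-- The bounded existential quantifier `∃ y ∈ x_i, φ`. -/
def bexMem {n : ℕ} (i : Fin n) (φ : BddFormula (n + 1)) : BddFormula n :=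
  neg (ballMem i (neg φ))

/-- Disjunction. -/
def or {n : ℕ} (φ ψ : BddFormula n) : BddFormula n := neg (and (neg φ) (neg ψ))

/-- The formula `x_p = (x_a, x_b)`. -/
def isPair {n : ℕ} (p a b : Fin n) : BddFormula n :=
  bexMem p <| bexMem p.succ <|
    -- Variable `1` is `u = {a}` and `0` is `v = {a, b}`; under one more quantifier they become `2`
    -- and `1`.
    ((mem a.succ.succ 1).and (ballMem 1 (eq 0 a.succ.succ.succ))).and <|
    (((mem a.succ.succ 0).and (mem b.succ.succ 0)).and
      (ballMem 0 ((eq 0 a.succ.succ.succ).or (eq 0 b.succ.succ.succ)))).and <|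
    ballMem p.succ.succ ((eq 0 2).or (eq 0 1))

variable {X : ZFSet.{u}} {n : ℕ} (v : Fin n → Superstructure X)

theorem holds_bexMem (i : Fin n) (φ : BddFormula (n + 1)) :
    (bexMem i φ).Holds v ↔ ∃ y, y ∈ v i ∧ φ.Holds (Fin.cons y v) := by
  simp [bexMem, Holds]

theorem holds_or (φ ψ : BddFormula n) : (φ.or ψ).Holds v ↔ φ.Holds v ∨ ψ.Holds v := by
  simp only [or, Holds]
  tauto

theorem holds_isPair (hX : IsBaseSet X) (p a b : Fin n) :
    (isPair p a b).Holds v ↔ v p = pair (v a) (v b) := by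
  rw [pair_eq_iff hX]
  simp only [isPair, holds_bexMem, holds_or, Holds, Fin.cons_succ, Fin.cons_zero]
  exact Iff.rfl

end BddFormula

/-! ### Iterated stars, coherence and monads of tensor products -/

namespace SingleModel

variable {X : ZFSet.{u}} (M : SingleModel X)

theorem star_pair (a b : Superstructure X) : M.star (pair a b) = pair (M.star a) (M.star b) := by
  have h := M.transfer (.isPair 0 1 2) ![pair a b, a, b]
  rw [BddFormula.holds_isPair _ M.base, BddFormula.holds_isPair _ M.base] at h
  exact h.1 rfl

theorem star_tuple {k : ℕ} (a : Fin (k + 1) → Superstructure X) :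
    M.star (tuple a) = tuple fun i => M.star (a i) := by
  induction k with
  | zero => rfl
  | succ k ih => exact (M.star_pair _ _).trans (congrArg _ (ih _))

variable {M} in
/-- The elements of a completely coherent set are fixed by `∗`. -/
theorem CompletelyCoherent.star_eq {Y : VSet X} (hY : M.CompletelyCoherent Y) (y : Y) :
    M.star y.1 = y.1 := by
  -- Coherence of `{y}` puts `y` in `∗{y}`, all of whose elements equal `∗y` by transfer.
  have key := M.transfer (.ballMem 0 (.eq 0 2)) ![(Y.sub {y}).toV, y.1]
  refine (key.1 ?_ y.1 (hY {y} y.1 ((VSet.mem_sub _ _ _).2 ⟨y.2, rfl⟩))).symm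
  intro z hz
  obtain ⟨_, h⟩ := (VSet.mem_sub _ _ _).1 hz
  exact congrArg Subtype.val h

variable {M} in
theorem CompletelyCoherent.iter_eq {Y : VSet X} (hY : M.CompletelyCoherent Y) (n : ℕ) (y : Y) :
    M.iter n y.1 = y.1 := by
  induction n with
  | zero => rfl
  | succ n ih => exact (congrArg M.star ih).trans (hY.star_eq y)

/-- Transfer of `{s} × A_s ⊆ A` along `S_n`; the parameter `s` becomes `S_n s`. -/
theorem pair_iter_mem (n : ℕ) {S T : VSet X} (A : Set (S.prod T)) (s : S) {β : Superstructure X}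
    (hβ : β ∈ M.iter n (T.sub {t | VSet.mkPair s t ∈ A}).toV) :
    pair (M.iter n s.1) β ∈ M.iter n ((S.prod T).sub A).toV := by
  have key := M.transfer_iter n (.ballMem 0 (.bexMem 2 (.isPair 0 4 1)))
    ![(T.sub {t | VSet.mkPair s t ∈ A}).toV, ((S.prod T).sub A).toV, s.1]
  simp only [BddFormula.Holds, BddFormula.holds_bexMem, BddFormula.holds_isPair _ M.base] at key
  obtain ⟨p, hp, h⟩ := key.1 (fun t ht => by
    obtain ⟨h1, h2⟩ := (VSet.mem_sub _ _ _).1 ht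
    exact ⟨pair s.1 t, (VSet.mem_sub _ _ _).2 ⟨(VSet.mkPair s ⟨t, h1⟩).2, h2⟩, rfl⟩) β hβ
  exact (show p = pair (M.iter n s.1) β from h) ▸ hp

/-- The parameters `C` and `β` are arbitrary, so they may already live in the `n`-th extension: this
is applied with `C = S_n(A)`. -/
theorem pair_star_mem {S : VSet X} (B : Set S) {C β α : Superstructure X}
    (h : ∀ s ∈ B, pair s.1 β ∈ C) (hα : α ∈ M.star (S.sub B).toV) :
    pair α (M.star β) ∈ M.star C := by
  have key := M.transfer (.ballMem 0 (.bexMem 2 (.isPair 0 1 4))) ![(S.sub B).toV, C, β]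
  simp only [BddFormula.Holds, BddFormula.holds_bexMem, BddFormula.holds_isPair _ M.base] at key
  obtain ⟨p, hp, h⟩ := key.1 (fun s hs => by
    obtain ⟨h1, h2⟩ := (VSet.mem_sub _ _ _).1 hs
    exact ⟨pair s β, h _ h2, rfl⟩) α hα
  exact (show p = pair α (M.star β) from h) ▸ hp

theorem pair_star_mem_monad {S T : VSet X} (hS : M.CompletelyCoherent S) {U : Ultrafilter S}
    {V : Ultrafilter T} {n : ℕ} {α β : Superstructure X} (hα : α ∈ M.monad 1 U)
    (hβ : β ∈ M.monad n V) : pair α (M.star β) ∈ M.monad (n + 1) (tensor₂ U V) := by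
  intro A hA
  refine M.pair_star_mem {s : S | {t : T | VSet.mkPair s t ∈ A} ∈ V} (fun s hs => ?_) (hα _ hA)
  have := M.pair_iter_mem n A s (hβ _ hs)
  -- Coherence replaces `S_n s` by `s`, so that the outer transfer can quantify over `s` itself.
  rwa [hS.iter_eq] at this

theorem tuple_iter_mem_monad {k : ℕ} {S : Fin (k + 1) → VSet X}
    (hS : ∀ i : Fin k, M.CompletelyCoherent (S i.castSucc))
    (U : (i : Fin (k + 1)) → Ultrafilter (S i)) {α : Fin (k + 1) → Superstructure X}
    (hα : ∀ i, α i ∈ M.monad 1 (U i)) :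
    tuple (fun i => M.iter i (α i)) ∈ M.monad (k + 1) (tensorN U) := by
  induction k with
  | zero => exact hα 0
  | succ k ih =>
    have h := ih (S := fun i => S i.succ) (fun i => hS i.succ) (fun i => U i.succ)
      (α := fun i => α i.succ) fun i => hα i.succ
    have h' := M.pair_star_mem_monad (hS 0) (hα 0) h
    -- Starring the tail raises each of its exponents by one, as the index shift requires.
    rwa [star_tuple] at h'

theorem monad_subset_generators (n : ℕ) {Y : VSet X} (U : Ultrafilter Y) :
    M.monad n U ⊆ M.generators U :=
  fun _ h A hA => ⟨n, h A hA⟩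

/-- An element of `μ_n(𝒰)` generates exactly `𝒰` in the extension `S_n`. -/
theorem mem_genSets_of_mem_monad {n : ℕ} {Y : VSet X} {U : Ultrafilter Y} {α : Superstructure X}
    (hα : α ∈ M.monad n U) (A : Set Y) : A ∈ M.genSets n Y α ↔ A ∈ U := by
  refine ⟨fun hA => ?_, hα A⟩
  -- Otherwise `Aᶜ ∈ U`, and `α` would lie in both of the disjoint sets `S_n(A)` and `S_n(Aᶜ)`.
  by_contra h
  have key := M.transfer_iter n (BddFormula.ballMem 0 (BddFormula.mem 0 2).neg)
    ![(Y.sub A).toV, (Y.sub Aᶜ).toV]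
  refine key.1 (fun y hy hy' => ?_) α hA (hα _ (Ultrafilter.compl_mem_iff_notMem.2 h))
  obtain ⟨_, h2⟩ := (VSet.mem_sub _ _ _).1 hy
  obtain ⟨_, h4⟩ := (VSet.mem_sub _ _ _).1 hy'
  exact h4 h2

end SingleModel

end Nonstandard

theorem mainTheorem7 {X : ZFSet.{u}} (M : Nonstandard.SingleModel X) (k : ℕ)
    (S : Fin (k + 1) → Nonstandard.VSet X)
    (hS : ∀ i : Fin k, M.CompletelyCoherent (S i.castSucc)) :
    (∀ (U : (i : Fin (k + 1)) → Ultrafilter (S i))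
        (α : Fin (k + 1) → Nonstandard.Superstructure X),
      (∀ i, α i ∈ M.monad 1 (U i)) →
        Nonstandard.tuple (fun i => M.iter i (α i)) ∈
            M.monad (k + 1) (Nonstandard.tensorN U) ∧
        Nonstandard.tuple (fun i => M.iter i (α i)) ∈
            M.generators (Nonstandard.tensorN U)) ∧
    (∀ (α : Fin (k + 1) → Nonstandard.Superstructure X)
        (hα : ∀ i, α i ∈ M.star (S i).toV),
      M.IsTensorTuple S α hα ↔
        M.Equivalent (Nonstandard.prodN S) 1 (Nonstandard.tuple α)
          (k + 1) (Nonstandard.tuple fun i => M.iter i (α i))) := by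
  refine ⟨fun U α hα => ?_, fun α hα => ?_⟩
  · have h := M.tuple_iter_mem_monad hS U hα
    exact ⟨h, M.monad_subset_generators _ _ h⟩
  -- Each `α_i` lies in `μ(𝔘_{α_i})` by definition, so (a) applies to these ultrafilters.
  · have h := M.tuple_iter_mem_monad hS (fun i => M.ultrafilter 1 (S i) (α i) (hα i))
      (α := α) fun i A hA => hA
    refine Iff.trans ?_ Set.ext_iff.symm
    exact forall_congr' fun A => iff_congr Iff.rfl (M.mem_genSets_of_mem_monad h A).symm
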